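/- **Proposition (Drift Restriction).** Fix a current time $t_0\in\mathbb R$ and a horizon $T_{FR}>0$, and let $\Delta=\{(t,x): t_0\le t\le x\le t_0+T_{FR}\}$ be the set of times $t$ and forward rate maturities $x$. Let $Q$ be a probability measure and let $A(t,x)$ be, under $Q$, a centred Gaussian field that is white noise in time with propagator $D$, i.e. $$E_Q[A(t,x)A(t',x')]=\delta(t-t')\,D(x,x';t,T_{FR}),$$ which means: for maturities $x,x'\in[t_0,t_0+T_{FR}]$ and square-integrable functions $h,g$ of time supported in $[t_0,x]$ and $[t_0,x']$ respectively, the variables $\int h(t)A(t,x)\,dt$ are jointly Gaussian with mean zero and $$E_Q\Big[\int h(t)A(t,x)\,dt\int g(t')A(t',x')\,dt'\Big]=\int h(t)g(t)D(x,x';t,T_{FR})\,dt .$$ Here $D$ is continuous in $(x,x',t)$ on $t_0\le t\le\min(x,x')$, $\max(x,x')\le t_0+T_{FR}$. Let $\alpha,\sigma:\Delta\to\mathbb R$ be continuous (deterministic) drift and volatility functions, let $f_0$ be an integrable initial forward curve on $[t_0,t_0+T_{FR}]$, and let the forward rates follow $\partial f/\partial t=\alpha+\sigma A$, i.e. $f$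 is jointly measurable in $(t,x,\omega)$ and, for each $(t,x)\in\Delta$, almost surely $$f(t,x)=f_0(x)+\int_{t_0}^t\alpha(s,x)\,ds+\int_{t_0}^t\sigma(s,x)A(s,x)\,ds .$$ Let $P(t,T)=\exp\big(-\int_t^T f(t,x)\,dx\big)$ be the bond prices and $r(t)=f(t,t)$ the spot rate. Assume no arbitrage, in the sense that $Q$ is a risk neutral measure: for every maturity $T\in[t_0,t_0+T_{FR}]$ the discounted bond price $e^{-\int_{t_0}^t r(s)\,ds}P(t,T)$, $t_0\le t\le T$, is a $Q$-martingale (for some given filtration). Then $$\alpha(t,x)=\sigma(t,x)\int_t^x D(x,x';t,T_{FR})\,\sigma(t,x')\,dx'\qquad\text{for all }(t,x)\in\Delta .$$ In particular this holds when $D$ is the propagator of the Lagrangian $-\frac1{2T_{FR}}\{A^2+\mu^{-2}(\partial A/\partial x)^2\}$: with $\tau=x-t$, $\tau'=x'-t$ and $\theta$ the Heaviside function ($\theta(0)=\tfrac12$), for $\mu>0$, $$\begin{aligned}D(x,x';t,T_{FR})=\frac{\mu T_{FR}}{\sinh(\mu T_{FR})}\Big[&\sinh\mu(T_{FR}-\tau)\sinh(\mu\tau')\theta(\tau-\tau')+\sinh\mu(T_{FR}-\tau')\sinh(\mu\tau)\theta(\tau'-\tau)\\&+\frac{1}{2\cosh^2(\mu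 T_{FR}/2)}\Big\{2\cosh\mu\big(\tau-\tfrac{T_{FR}}2\big)\cosh\mu\big(\tau'-\tfrac{T_{FR}}2\big)\\&\qquad+\sinh(\mu\tau)\sinh(\mu\tau')+\sinh\mu(T_{FR}-\tau)\sinh\mu(T_{FR}-\tau')\Big\}\Big],\end{aligned}$$ and $D=1$ (the limit) for $\mu=0$. If $D\equiv1$, the drift reduces to that of the one factor HJM model, $\alpha(t,x)=\sigma(t,x)\int_t^x\sigma(t,x')\,dx'$. -/

import Mathlib

open MeasureTheory ProbabilityTheory Set

noncomputable section

namespace FieldHJM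

/-- The Heaviside step function, with the symmetric convention `θ(0) = 1/2`. -/
def heaviside (u : ℝ) : ℝ := if u < 0 then 0 else if u = 0 then 1 / 2 else 1

/-- The propagator `D(x,x';t,T_FR)` of the Lagrangian
`-(1 / (2 T_FR)) (A² + μ⁻² (∂A/∂x)²)`, in the times to maturity `τ = x - t`, `τ' = x' - t`.
For `μ = 0` (the infinitely rigid string) it is the limiting value `1`. -/
def lagrangianPropagator (μ T_FR x x' t : ℝ) : ℝ :=
  if μ = 0 then 1 else
    let τ := x - t
    let τ' := x' - t
    μ * T_FR / Real.sinh (μ * T_FR) *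
      (Real.sinh (μ * (T_FR - τ)) * Real.sinh (μ * τ') * heaviside (τ - τ')
        + Real.sinh (μ * (T_FR - τ')) * Real.sinh (μ * τ) * heaviside (τ' - τ)
        + 1 / (2 * Real.cosh (μ * T_FR / 2) ^ 2) *
          (2 * Real.cosh (μ * (τ - T_FR / 2)) * Real.cosh (μ * (τ' - T_FR / 2))
            + Real.sinh (μ * τ) * Real.sinh (μ * τ')
            + Real.sinh (μ * (T_FR - τ)) * Real.sinh (μ * (T_FR - τ'))))

/-- Pairs `(t, x)` of a time and a forward rate maturity: `t₀ ≤ t ≤ x ≤ t₀ + T_FR`. -/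
def rateDomain (t₀ T_FR : ℝ) : Set (ℝ × ℝ) :=
  {p | t₀ ≤ p.1 ∧ p.1 ≤ p.2 ∧ p.2 ≤ t₀ + T_FR}

/-- Triples `(x, x', t)` such that `(t, x)` and `(t, x')` both lie in `rateDomain t₀ T_FR`. -/
def propagatorDomain (t₀ T_FR : ℝ) : Set (ℝ × ℝ × ℝ) :=
  {p | (p.2.2, p.1) ∈ rateDomain t₀ T_FR ∧ (p.2.2, p.2.1) ∈ rateDomain t₀ T_FR}

/-- Pairs `(h, x)` of a square-integrable test function of time `h` and a maturity
`x ∈ [t₀, t₀ + T_FR]`, where `h` vanishes outside `[t₀, x]` (the times at which the rate of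
maturity `x` is alive). -/
def testPairs (t₀ T_FR : ℝ) : Set ((ℝ → ℝ) × ℝ) :=
  {p | MemLp p.1 2 volume ∧ p.2 ∈ Icc t₀ (t₀ + T_FR) ∧ ∀ s, s ∉ Icc t₀ p.2 → p.1 s = 0}

variable {Ω : Type*} [mΩ : MeasurableSpace Ω]

/-- `A` is, under `Q`, a centred Gaussian field with
`E[A(t,x) A(t',x')] = δ(t - t') D(x,x';t)`. As the field is white noise in time, it is
given by its integrals against test functions of time: `A h x` stands for `∫ h(t) A(t,x) dt`.
The correlator, integrated against `h(t) g(t')`, reads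
`E[(∫ h(t) A(t,x) dt) (∫ g(t') A(t',x') dt')] = ∫ h(t) g(t) D(x,x';t) dt`. -/
structure IsFieldWithPropagator (Q : Measure Ω) (t₀ T_FR : ℝ) (D : ℝ → ℝ → ℝ → ℝ)
    (A : (ℝ → ℝ) → ℝ → Ω → ℝ) : Prop where
  gaussian : IsGaussianProcess (fun p : testPairs t₀ T_FR => A p.1.1 p.1.2) Q
  mean : ∀ h x, (h, x) ∈ testPairs t₀ T_FR → ∫ ω, A h x ω ∂Q = 0
  correlator : ∀ h x g x', (h, x) ∈ testPairs t₀ T_FR → (g, x') ∈ testPairs t₀ T_FR →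
    ∫ ω, A h x ω * A g x' ω ∂Q = ∫ t, h t * g t * D x x' t

/-- The forward rates `f(t,x)` evolve from the initial curve `f₀` by `∂f/∂t = α + σ A`, that is
`f(t,x) = f₀(x) + ∫_{t₀}^t α(s,x) ds + ∫_{t₀}^t σ(s,x) A(s,x) ds` almost surely,
for each time `t` and maturity `x`. The process `f` is a jointly measurable version. -/
structure IsForwardRate (Q : Measure Ω) (t₀ T_FR : ℝ) (A : (ℝ → ℝ) → ℝ → Ω → ℝ)
    (α σ : ℝ → ℝ → ℝ) (f₀ : ℝ → ℝ) (f : ℝ → ℝ → Ω → ℝ) : Prop where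
  measurable : Measurable fun p : ℝ × ℝ × Ω => f p.1 p.2.1 p.2.2
  evolution : ∀ t x, (t, x) ∈ rateDomain t₀ T_FR → ∀ᵐ ω ∂Q,
    f t x ω = f₀ x + (∫ s in t₀..t, α s x) + A ((Icc t₀ t).indicator fun s => σ s x) x ω

/-- The zero coupon bond price `P(t,T) = exp(-∫_t^T f(t,x) dx)`. -/
def bondPrice (f : ℝ → ℝ → Ω → ℝ) (t T : ℝ) (ω : Ω) : ℝ :=
  Real.exp (-∫ x in t..T, f t x ω)

/-- The bond price discounted to time `t₀` with the spot rate `r(s) = f(s,s)`. -/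
def discountedBondPrice (f : ℝ → ℝ → Ω → ℝ) (t₀ t T : ℝ) (ω : Ω) : ℝ :=
  Real.exp (-∫ s in t₀..t, f s s ω) * bondPrice f t T ω

/-- A filtration indexed by the real line, seen on the times in `[a, b]`. -/
def filtrationOn (ℱ : Filtration ℝ mΩ) (a b : ℝ) : Filtration (Icc a b) mΩ where
  seq t := ℱ t
  mono' _ _ h := ℱ.mono h
  le' t := ℱ.le t

/-- No arbitrage: `Q` is a risk neutral measure, i.e. for every maturity
`T ∈ [t₀, t₀ + T_FR]` the discounted price of the bond maturing at `T` is a `Q`-martingale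
over the life `[t₀, T]` of the bond. -/
def IsRiskNeutral (Q : Measure Ω) (ℱ : Filtration ℝ mΩ) (t₀ T_FR : ℝ)
    (f : ℝ → ℝ → Ω → ℝ) : Prop :=
  ∀ T ∈ Icc t₀ (t₀ + T_FR),
    Martingale (fun t : Icc t₀ T => discountedBondPrice f t₀ t T) (filtrationOn ℱ t₀ T) Q

end FieldHJM

end

namespace FieldHJM

open Filter Topology Function

/-! ### Integrals of Gaussian processes over a parameter. -/

section GaussianIntegral

variable {Ω S : Type*} [mΩ : MeasurableSpace Ω] {Q : Measure Ω}

/-! Since `r(s) = f(s,s)`, the discounted bond price is a single exponential, `exp(-∫_{t₀}^T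
f(min(t,x),x) dx)`. Its exponent is deterministic up to the integral over `x` of a centred Gaussian
process, so its mean is explicit (`integral_discountedBondPrice`): `exp(-∫_{t₀}^T f₀ - ∫_{t₀}^t
∫_u^T α + ½ ∫_{t₀}^t ∫_u^T ∫_u^T σ σ D)`. A martingale has constant mean, and at `t = t₀` only the
`f₀` term remains, so twice the drift integral equals the variance for all `t ≤ T`. Differentiating
in `t` gives `2 ∫_t^T α(t,x) dx = ∫_t^T ∫_t^T σ σ D`. As `D` is symmetric, the square is twice the
triangle `x' ≤ x`, and differentiating in `T` gives the drift (`drift_eq_of_integral_identity`). Two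
supporting facts are needed. The integral over `x` is Gaussian because it lies in the `L²` closure
of the span of the process (`map_integral_eq_gaussianReal`). The symmetry of `D` is not assumed: it
follows from that of the correlator (`propagator_symm`). -/

lemma norm_sq_lp_eq_integral (Z : Lp ℝ 2 Q) : ‖Z‖ ^ 2 = ∫ ω, Z ω ^ 2 ∂Q := by
  rw [← real_inner_self_eq_norm_sq, L2.inner_def]
  simp [sq]

/-- Centred Gaussian variables, characterised by their characteristic function. -/
def IsCentredGaussian (Q : Measure Ω) (Z : Lp ℝ 2 Q) : Prop :=
  ∀ s : ℝ, ∫ ω, Complex.exp (s * Z ω * Complex.I) ∂Q =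
    Complex.exp (-(((‖Z‖ ^ 2 : ℝ) : ℂ) * s ^ 2 / 2))

/-- An `L²`-convergent sequence has an a.e. convergent subsequence; along it the characteristic
functions converge by dominated convergence (the integrand has modulus 1), and the variances
converge because the norm is continuous. -/
lemma isClosed_isCentredGaussian [IsProbabilityMeasure Q] :
    IsClosed {Z : Lp ℝ 2 Q | IsCentredGaussian Q Z} := by
  refine IsSeqClosed.isClosed fun Z Z' hZ hlim s => ?_
  obtain ⟨ns, hns, hae⟩ := (tendstoInMeasure_of_tendsto_Lp hlim).exists_seq_tendsto_ae
  have h1 : Tendsto (fun n => ∫ ω, Complex.exp (s * Z (ns n) ω * Complex.I) ∂Q) atTop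
      (𝓝 (∫ ω, Complex.exp (s * Z' ω * Complex.I) ∂Q)) := by
    refine tendsto_integral_of_dominated_convergence (fun _ => 1) (fun n => ?_)
      (integrable_const _) (fun n => ?_) ?_
    · exact Continuous.comp_aestronglyMeasurable
        (g := fun y : ℝ => Complex.exp (s * y * Complex.I)) (by fun_prop)
        (Lp.aestronglyMeasurable _)
    · refine ae_of_all _ fun ω => ?_
      rw [← Complex.ofReal_mul, Complex.norm_exp_ofReal_mul_I]
    · filter_upwards [hae] with ω hω
      exact ((by fun_prop : Continuous fun y : ℝ => Complex.exp (s * y * Complex.I)).tendsto _).comp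
        hω
  have h2 : Tendsto (fun n => Complex.exp (-(((‖Z (ns n)‖ ^ 2 : ℝ) : ℂ) * s ^ 2 / 2))) atTop
      (𝓝 (Complex.exp (-(((‖Z'‖ ^ 2 : ℝ) : ℂ) * s ^ 2 / 2)))) :=
    ((by fun_prop : Continuous fun Y : Lp ℝ 2 Q =>
      Complex.exp (-(((‖Y‖ ^ 2 : ℝ) : ℂ) * s ^ 2 / 2))).tendsto _).comp
      (hlim.comp hns.tendsto_atTop)
  refine tendsto_nhds_unique h1 (h2.congr fun n => ?_)
  exact (hZ (ns n) s).symm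

lemma HasGaussianLaw.isCentredGaussian {Z : Lp ℝ 2 Q} (hZ : HasGaussianLaw Z Q)
    (hmean : ∫ ω, Z ω ∂Q = 0) : IsCentredGaussian Q Z := by
  intro s
  have hm : AEMeasurable Z Q := hZ.aemeasurable
  have h := congrArg (fun m => charFun m s) hZ.map_eq_gaussianReal
  simp only [hmean] at h
  rw [charFun_gaussianReal, charFun_apply_real, integral_map hm (by fun_prop), variance_of_integral_eq_zero hm hmean,
    ← norm_sq_lp_eq_integral, Real.coe_toNNReal _ (by positivity)] at h
  rw [h]
  congr 1
  push_cast
  ring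

lemma IsCentredGaussian.map_eq [IsProbabilityMeasure Q] {Z : Lp ℝ 2 Q}
    (hZ : IsCentredGaussian Q Z) : Q.map Z = gaussianReal 0 (‖Z‖ ^ 2).toNNReal := by
  have hm : AEMeasurable Z Q := (Lp.aestronglyMeasurable Z).aemeasurable
  have := Measure.isProbabilityMeasure_map hm
  refine Measure.ext_of_charFun ?_
  ext s
  rw [charFun_gaussianReal, charFun_apply_real, integral_map hm (by fun_prop), hZ s,
    Real.coe_toNNReal _ (by positivity)]
  congr 1
  push_cast
  ring

lemma isCentredGaussian_of_mem_span {G : S → Ω → ℝ} (hG : IsGaussianProcess G Q)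
    (hmean : ∀ x, ∫ ω, G x ω ∂Q = 0) {Z : Lp ℝ 2 Q}
    (hZ : Z ∈ Submodule.span ℝ
      (range fun x => (hG.hasGaussianLaw_eval x).memLp_two.toLp (G x))) :
    IsCentredGaussian Q Z := by
  obtain ⟨c, rfl⟩ := Finsupp.mem_span_range_iff_exists_finsupp.1 hZ
  have key : (⇑(c.sum fun i a => a • (hG.hasGaussianLaw_eval i).memLp_two.toLp (G i)) : Ω → ℝ)
      =ᵐ[Q] fun ω => ∑ i ∈ c.support, c i • G i ω := by
    have h1 : ∀ᵐ ω ∂Q, ∀ i ∈ c.support,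
        (c i • (hG.hasGaussianLaw_eval i).memLp_two.toLp (G i) : Lp ℝ 2 Q) ω = c i • G i ω := by
      refine (ae_ball_iff c.support.countable_toSet).2 fun i _ => ?_
      filter_upwards [Lp.coeFn_smul (c i) ((hG.hasGaussianLaw_eval i).memLp_two.toLp (G i)),
        (hG.hasGaussianLaw_eval i).memLp_two.coeFn_toLp] with ω h2 h3
      rw [h2, Pi.smul_apply, h3]
    filter_upwards [h1, Lp.coeFn_fun_finsetSum c.support
      fun i => c i • (hG.hasGaussianLaw_eval i).memLp_two.toLp (G i)] with ω h2 h3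
    rw [Finsupp.sum, h3]
    exact Finset.sum_congr rfl fun i hi => h2 i hi
  refine HasGaussianLaw.isCentredGaussian
    ((hG.smul c).hasGaussianLaw_fun_sum.congr key.symm) ?_
  rw [integral_congr_ae key, integral_finsetSum]
  · simp [integral_const_mul, hmean]
  · exact fun i _ => ((hG.hasGaussianLaw_eval i).integrable).smul (c i)

lemma integral_norm_mul_le {U V : Ω → ℝ} (hU : MemLp U 2 Q) (hV : MemLp V 2 Q) :
    ∫ ω, ‖U ω * V ω‖ ∂Q ≤ (∫ ω, U ω ^ 2 ∂Q) + ∫ ω, V ω ^ 2 ∂Q := by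
  rw [← integral_add hU.integrable_sq hV.integrable_sq]
  refine integral_mono (hU.integrable_mul hV).norm (hU.integrable_sq.add hV.integrable_sq)
    fun ω => ?_
  change |U ω * V ω| ≤ U ω ^ 2 + V ω ^ 2
  rw [abs_le]
  constructor <;> nlinarith [sq_nonneg (U ω + V ω), sq_nonneg (U ω - V ω)]

variable [MeasurableSpace S] {ν : Measure S} [IsFiniteMeasure ν] [IsProbabilityMeasure Q]
  {G : S → Ω → ℝ}

/-- Justifies Fubini when the integral of `G` is tested against a square-integrable `W`. -/
lemma integrable_mul_of_sq_bounded (hG : AEStronglyMeasurable (uncurry G) (ν.prod Q)) {C : ℝ}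
    (hL : ∀ x, MemLp (G x) 2 Q) (hC : ∀ x, ∫ ω, G x ω ^ 2 ∂Q ≤ C) {W : Ω → ℝ}
    (hW : MemLp W 2 Q) : Integrable (fun p : S × Ω => W p.2 * G p.1 p.2) (ν.prod Q) := by
  have hm : AEStronglyMeasurable (fun p : S × Ω => W p.2 * G p.1 p.2) (ν.prod Q) :=
    hW.aestronglyMeasurable.comp_snd.mul hG
  refine (integrable_prod_iff hm).2 ⟨ae_of_all _ fun x => hW.integrable_mul (hL x), ?_⟩
  refine Integrable.of_bound hm.norm.integral_prod_right' ((∫ ω, W ω ^ 2 ∂Q) + C)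
    (ae_of_all _ fun x => ?_)
  rw [Real.norm_of_nonneg (integral_nonneg fun _ => norm_nonneg _)]
  exact (integral_norm_mul_le hW (hL x)).trans (by gcongr; exact hC x)

/-- Justifies Fubini for the second moment of the integral of `G`. -/
lemma integrable_mul_mul_of_sq_bounded (hG : AEStronglyMeasurable (uncurry G) (ν.prod Q)) {C : ℝ}
    (hL : ∀ x, MemLp (G x) 2 Q) (hC : ∀ x, ∫ ω, G x ω ^ 2 ∂Q ≤ C) :
    Integrable (fun p : (S × S) × Ω => G p.1.1 p.2 * G p.1.2 p.2) ((ν.prod ν).prod Q) := by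
  have hm : AEStronglyMeasurable (fun p : (S × S) × Ω => G p.1.1 p.2 * G p.1.2 p.2)
      ((ν.prod ν).prod Q) :=
    (hG.comp_quasiMeasurePreserving
      (QuasiMeasurePreserving.prodMap Measure.quasiMeasurePreserving_fst (Measure.QuasiMeasurePreserving.id Q))).mul
    (hG.comp_quasiMeasurePreserving
      (QuasiMeasurePreserving.prodMap Measure.quasiMeasurePreserving_snd (Measure.QuasiMeasurePreserving.id Q)))
  refine (integrable_prod_iff hm).2 ⟨ae_of_all _ fun x => (hL x.1).integrable_mul (hL x.2), ?_⟩
  refine Integrable.of_bound hm.norm.integral_prod_right' (C + C) (ae_of_all _ fun x => ?_)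
  rw [Real.norm_of_nonneg (integral_nonneg fun _ => norm_nonneg _)]
  exact (integral_norm_mul_le (hL x.1) (hL x.2)).trans (add_le_add (hC _) (hC _))

/-- The integral of a centred Gaussian process with bounded variance is Gaussian. -/
theorem map_integral_eq_gaussianReal (hG : AEStronglyMeasurable (uncurry G) (ν.prod Q)) {C : ℝ}
    (hGauss : IsGaussianProcess G Q) (hmean : ∀ x, ∫ ω, G x ω ∂Q = 0)
    (hC : ∀ x, ∫ ω, G x ω ^ 2 ∂Q ≤ C) :
    Q.map (fun ω => ∫ x, G x ω ∂ν) =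
      gaussianReal 0 (∫ p : S × S, ∫ ω, G p.1 ω * G p.2 ω ∂Q ∂(ν.prod ν)).toNNReal := by
  have hL : ∀ x, MemLp (G x) 2 Q := fun x => (hGauss.hasGaussianLaw_eval x).memLp_two
  have h3 := integrable_mul_mul_of_sq_bounded hG hL hC
  have hXm : AEStronglyMeasurable (fun ω => ∫ x, G x ω ∂ν) Q := hG.prod_swap.integral_prod_right'
  have hsq : ∀ ω, (∫ x, G x ω ∂ν) ^ 2 = ∫ p : S × S, G p.1 ω * G p.2 ω ∂(ν.prod ν) := fun ω => by
    rw [sq, integral_prod_mul (fun x => G x ω) (fun x => G x ω)]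
  have hX : MemLp (fun ω => ∫ x, G x ω ∂ν) 2 Q := by
    rw [memLp_two_iff_integrable_sq hXm]
    simp_rw [hsq]
    exact h3.integral_prod_right
  -- The closure of the span is its double orthogonal complement. If `W` is orthogonal to every `G
  -- x`, Fubini makes it orthogonal to their integral, so no Riemann sums are needed.
  have hmem : hX.toLp _ ∈ (Submodule.span ℝ
      (range fun x => (hGauss.hasGaussianLaw_eval x).memLp_two.toLp (G x))).topologicalClosure := by
    rw [← Submodule.orthogonal_orthogonal_eq_closure]
    intro W hW
    have hWL : MemLp W 2 Q := Lp.memLp W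
    rw [L2.inner_def]
    have e1 : (fun ω => inner ℝ (W ω) (hX.toLp _ ω)) =ᵐ[Q] fun ω => ∫ x, W ω * G x ω ∂ν := by
      filter_upwards [hX.coeFn_toLp] with ω hω
      rw [hω, integral_const_mul]
      simp [mul_comm]
    rw [integral_congr_ae e1, ← integral_integral_swap
      (f := fun x ω => W ω * G x ω) (integrable_mul_of_sq_bounded hG hL hC hWL)]
    refine integral_eq_zero_of_ae (ae_of_all _ fun x => ?_)
    have h0 := (Submodule.mem_orthogonal _ W).1 hW _ (Submodule.subset_span ⟨x, rfl⟩)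
    rw [L2.inner_def] at h0
    simp only [Pi.zero_apply]
    rw [← h0]
    refine integral_congr_ae ?_
    filter_upwards [(hL x).coeFn_toLp] with ω hω
    simp [hω]
  have hcg : IsCentredGaussian Q (hX.toLp _) :=
    isClosed_isCentredGaussian.closure_subset_iff.2
      (fun Z hZ => isCentredGaussian_of_mem_span hGauss hmean hZ) hmem
  rw [← Measure.map_congr hX.coeFn_toLp, hcg.map_eq, norm_sq_lp_eq_integral]
  congr 2
  rw [integral_integral_swap (f := fun (p : S × S) ω => G p.1 ω * G p.2 ω) h3]
  refine integral_congr_ae ?_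
  filter_upwards [hX.coeFn_toLp] with ω hω
  rw [hω, hsq]

lemma integrable_of_sq_bounded (hG : AEStronglyMeasurable (uncurry G) (ν.prod Q)) {C : ℝ}
    (hL : ∀ x, MemLp (G x) 2 Q) (hC : ∀ x, ∫ ω, G x ω ^ 2 ∂Q ≤ C) :
    Integrable (uncurry G) (ν.prod Q) := by
  refine (integrable_mul_of_sq_bounded hG hL hC (memLp_const 1)).congr (ae_of_all _ fun p => ?_)
  simp [uncurry]

/-- The Gaussian moment generating function evaluated at `-1`. -/
theorem integral_exp_neg_integral (hG : AEStronglyMeasurable (uncurry G) (ν.prod Q)) {C : ℝ}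
    (hGauss : IsGaussianProcess G Q) (hmean : ∀ x, ∫ ω, G x ω ∂Q = 0)
    (hC : ∀ x, ∫ ω, G x ω ^ 2 ∂Q ≤ C) :
    ∫ ω, Real.exp (-∫ x, G x ω ∂ν) ∂Q =
      Real.exp ((∫ p : S × S, ∫ ω, G p.1 ω * G p.2 ω ∂Q ∂(ν.prod ν)) / 2) := by
  have hL : ∀ x, MemLp (G x) 2 Q := fun x => (hGauss.hasGaussianLaw_eval x).memLp_two
  have h := mgf_gaussianReal (map_integral_eq_gaussianReal hG hGauss hmean hC) (-1)
  have hnn : 0 ≤ ∫ p : S × S, ∫ ω, G p.1 ω * G p.2 ω ∂Q ∂(ν.prod ν) := by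
    rw [integral_integral_swap (f := fun (p : S × S) ω => G p.1 ω * G p.2 ω)
      (integrable_mul_mul_of_sq_bounded hG hL hC)]
    refine integral_nonneg fun ω => ?_
    rw [integral_prod_mul (fun x => G x ω) (fun x => G x ω)]
    exact mul_self_nonneg _
  rw [mgf, Real.coe_toNNReal _ hnn] at h
  simpa using h

end GaussianIntegral

/-! ### Exchange of integrals and localisation of the drift identity. -/

section DoubleIntegrals

/-- Differentiation gives the interior points, continuity the endpoints. This is the form in which
every differentiation below is carried out. -/
lemma eq_zero_of_integral_eq_zero {g : ℝ → ℝ} (hg : Continuous g) {a b : ℝ} (hab : a < b)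
    (h : ∀ t ∈ Icc a b, ∫ u in a..t, g u = 0) : ∀ t ∈ Icc a b, g t = 0 := by
  have h1 : EqOn g 0 (Ioo a b) := fun t ht => by
    have hd : HasDerivAt (fun t => ∫ u in a..t, g u) (g t) t := hg.integral_hasStrictDerivAt a t
      |>.hasDerivAt
    have hz : (fun t => ∫ u in a..t, g u) =ᶠ[𝓝 t] fun _ => 0 := by
      filter_upwards [Ioo_mem_nhds ht.1 ht.2] with y hy using h y (Ioo_subset_Icc_self hy)
    exact (hd.congr_of_eventuallyEq hz.symm).unique (hasDerivAt_const t (0 : ℝ))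
  have h2 := h1.closure hg continuous_const
  rwa [closure_Ioo hab.ne] at h2

/-- Fubini on the region `a < u ≤ t`, `u ≤ m p`. It is used with `m p = x` for the drift and `m p =
min x x'` for the covariance. -/
lemma integral_integral_le_swap {S : Type*} [MeasurableSpace S] {ρ : Measure S} [SFinite ρ]
    {m : S → ℝ} (hm : Measurable m) {a t : ℝ} (hat : a ≤ t) (ham : ∀ᵐ p ∂ρ, a ≤ m p)
    {k : ℝ → S → ℝ} (hk : Integrable (uncurry k) ((volume.restrict (Ioc a t)).prod ρ)) :
    ∫ p, (∫ u in a..min t (m p), k u p) ∂ρ = ∫ u in a..t, ∫ p in {p | u ≤ m p}, k u p ∂ρ := by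
  have hs : MeasurableSet {q : ℝ × S | q.1 ≤ m q.2} :=
    measurableSet_le measurable_fst (hm.comp measurable_snd)
  have hi := hk.indicator hs
  rw [intervalIntegral.integral_of_le hat]
  have e := integral_integral_swap
    (f := fun u p => {q : ℝ × S | q.1 ≤ m q.2}.indicator (uncurry k) (u, p)) hi
  have e1 : ∀ u, ∫ p, {q : ℝ × S | q.1 ≤ m q.2}.indicator (uncurry k) (u, p) ∂ρ =
      ∫ p in {p | u ≤ m p}, k u p ∂ρ := fun u => by
    rw [← integral_indicator (measurableSet_le measurable_const hm)]
    rfl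
  simp_rw [e1] at e
  rw [e]
  refine integral_congr_ae ?_
  filter_upwards [ham] with p hp
  rw [intervalIntegral.integral_of_le (le_min hat hp), ← Ioc_inter_Iic,
    ← setIntegral_indicator measurableSet_Iic]
  rfl

lemma integrable_prod_restrict_Ioc {X : Type*} [TopologicalSpace X] [T2Space X] [MeasurableSpace X]
    [OpensMeasurableSpace (ℝ × X)] [SecondCountableTopologyEither (ℝ × X) ℝ]
    {μ : Measure X} [SFinite μ] [IsFiniteMeasureOnCompacts ((volume : Measure ℝ).prod μ)]
    {k : ℝ → X → ℝ} (hk : Continuous (uncurry k)) {s K : Set X} (hK : IsCompact K)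
    (hsK : s ⊆ K) {a t : ℝ} :
    Integrable (uncurry k) ((volume.restrict (Ioc a t)).prod (μ.restrict s)) := by
  rw [Measure.prod_restrict]
  refine IntegrableOn.mono_set ?_ (prod_mono Ioc_subset_Icc_self hsK)
  have hc : IsCompact (Icc a t ×ˢ K) := isCompact_Icc.prod hK
  exact hk.continuousOn.integrableOn_compact' hc hc.measurableSet

lemma setIntegral_restrict_Ici {h : ℝ → ℝ} {a u T : ℝ} (hau : a < u) (huT : u ≤ T) :
    ∫ x in {x | u ≤ x}, h x ∂(volume.restrict (Ioc a T)) = ∫ x in u..T, h x := by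
  have hs : {x | u ≤ x} ∩ Ioc a T = Icc u T := by
    ext x
    simp only [mem_inter_iff, mem_ofPred_eq, mem_Ioc, mem_Icc]
    exact ⟨fun h => ⟨h.1, h.2.2⟩, fun h => ⟨h.1, hau.trans_le h.1, h.2⟩⟩
  rw [Measure.restrict_restrict (measurableSet_le measurable_const measurable_id' : MeasurableSet {x | u ≤ x}), hs,
    integral_Icc_eq_integral_Ioc, intervalIntegral.integral_of_le huT]

lemma integral_triangle_swap {k : ℝ → ℝ → ℝ} (hk : Continuous (uncurry k)) {a t T : ℝ}
    (hat : a ≤ t) (htT : t ≤ T) :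
    ∫ x in a..T, ∫ u in a..min t x, k u x = ∫ u in a..t, ∫ x in u..T, k u x := by
  rw [intervalIntegral.integral_of_le (hat.trans htT),
    integral_integral_le_swap (m := fun x => x) measurable_id hat ?_
      (integrable_prod_restrict_Ioc hk isCompact_Icc Ioc_subset_Icc_self)]
  · rw [intervalIntegral.integral_of_le hat, intervalIntegral.integral_of_le hat]
    exact setIntegral_congr_fun measurableSet_Ioc fun u hu =>
      setIntegral_restrict_Ici hu.1 (hu.2.trans htT)
  · exact (ae_restrict_mem measurableSet_Ioc).mono fun x hx => hx.1.le

lemma integral_pyramid_swap {k : ℝ → ℝ → ℝ → ℝ}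
    (hk : Continuous fun p : ℝ × ℝ × ℝ => k p.1 p.2.1 p.2.2) {a t T : ℝ}
    (hat : a ≤ t) (htT : t ≤ T) :
    ∫ p : ℝ × ℝ, (∫ u in a..min t (min p.1 p.2), k u p.1 p.2)
      ∂((volume.restrict (Ioc a T)).prod (volume.restrict (Ioc a T))) =
    ∫ u in a..t, ∫ x in u..T, ∫ x' in u..T, k u x x' := by
  rw [integral_integral_le_swap (k := fun u p => k u p.1 p.2)
    (measurable_fst.min measurable_snd) hat]
  · rw [intervalIntegral.integral_of_le hat, intervalIntegral.integral_of_le hat]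
    refine setIntegral_congr_fun measurableSet_Ioc fun u hu => ?_
    have hs : {p : ℝ × ℝ | u ≤ min p.1 p.2} ∩ Ioc a T ×ˢ Ioc a T = Icc u T ×ˢ Icc u T := by
      ext p
      simp only [mem_inter_iff, mem_ofPred_eq, mem_prod, mem_Ioc, mem_Icc, le_min_iff]
      exact ⟨fun h => ⟨⟨h.1.1, h.2.1.2⟩, h.1.2, h.2.2.2⟩, fun h => ⟨⟨h.1.1, h.2.1⟩,
        ⟨hu.1.trans_le h.1.1, h.1.2⟩, hu.1.trans_le h.2.1, h.2.2⟩⟩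
    have hcont : Continuous fun p : ℝ × ℝ => k u p.1 p.2 :=
      hk.comp (by fun_prop : Continuous fun p : ℝ × ℝ => (u, p.1, p.2))
    rw [Measure.prod_restrict, Measure.restrict_restrict
      (measurableSet_le measurable_const (measurable_fst.min measurable_snd)), hs,
      setIntegral_prod]
    · have huT := hu.2.trans htT
      simp only [intervalIntegral.integral_of_le huT, integral_Icc_eq_integral_Ioc]
    · exact hcont.continuousOn.integrableOn_compact (isCompact_Icc.prod isCompact_Icc)
  · rw [Measure.prod_restrict]
    exact (ae_restrict_mem (measurableSet_Ioc.prod measurableSet_Ioc)).mono fun p hp =>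
      le_min hp.1.1.le hp.2.1.le
  · rw [Measure.prod_restrict]
    exact integrable_prod_restrict_Ioc hk (isCompact_Icc.prod isCompact_Icc)
      (prod_mono Ioc_subset_Icc_self Ioc_subset_Icc_self)

/-- The diagonal cuts the square into two triangles, which the symmetry of `k` exchanges. -/
lemma integral_square_eq_two_mul_of_symm {k : ℝ → ℝ → ℝ} (hk : Continuous (uncurry k)) {t T : ℝ}
    (htT : t ≤ T) (hsymm : ∀ x ∈ Icc t T, ∀ x' ∈ Icc t T, k x x' = k x' x) :
    ∫ x in t..T, ∫ x' in t..T, k x x' = 2 * ∫ x in t..T, ∫ x' in t..x, k x x' := by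
  have hki : ∀ x b c, IntervalIntegrable (k x) volume b c := fun x b c =>
    (hk.comp (by fun_prop : Continuous fun y : ℝ => (x, y))).intervalIntegrable b c
  have hlow : Continuous fun x => ∫ x' in t..x, k x x' :=
    intervalIntegral.continuous_parametric_intervalIntegral_of_continuous hk continuous_id
  have hup : Continuous fun x => ∫ x' in x..T, k x x' := by
    rw [funext fun x => intervalIntegral.integral_symm (f := k x) T x]
    exact (intervalIntegral.continuous_parametric_intervalIntegral_of_continuous hk
      continuous_id).neg
  have hsplit : ∀ x, ∫ x' in t..T, k x x' = (∫ x' in t..x, k x x') + ∫ x' in x..T, k x x' :=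
    fun x => (intervalIntegral.integral_add_adjacent_intervals (hki x _ _) (hki x _ _)).symm
  have hswap : ∫ x in t..T, ∫ x' in x..T, k x x' = ∫ x in t..T, ∫ x' in t..x, k x x' := by
    rw [← integral_triangle_swap hk htT le_rfl]
    refine intervalIntegral.integral_congr fun x hx => ?_
    rw [uIcc_of_le htT] at hx
    simp only [min_eq_right hx.2]
    refine intervalIntegral.integral_congr fun x' hx' => ?_
    rw [uIcc_of_le hx.1] at hx'
    exact hsymm x' ⟨hx'.1, hx'.2.trans hx.2⟩ x hx
  simp_rw [hsplit]
  rw [intervalIntegral.integral_add (hlow.intervalIntegrable _ _) (hup.intervalIntegrable _ _),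
    hswap]
  ring

/-- The double integral identity between drift and covariance, localised. -/
theorem drift_eq_of_integral_identity {a s : ℝ → ℝ → ℝ} {d : ℝ → ℝ → ℝ → ℝ} {t₀ E : ℝ}
    (ha : Continuous (uncurry a)) (hs : Continuous (uncurry s))
    (hd : Continuous fun p : ℝ × ℝ × ℝ => d p.1 p.2.1 p.2.2) (hE : t₀ < E)
    (hsymm : ∀ u, ∀ x ∈ Icc t₀ E, ∀ x' ∈ Icc t₀ E, d x x' u = d x' x u)
    (hid : ∀ T ∈ Icc t₀ E, ∀ t ∈ Icc t₀ T,
      2 * ∫ u in t₀..t, ∫ x in u..T, a u x =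
        ∫ u in t₀..t, ∫ x in u..T, ∫ x' in u..T, s u x * s u x' * d x x' u) :
    ∀ t x, t₀ ≤ t → t ≤ x → x ≤ E → a t x = s t x * ∫ x' in t..x, d x x' t * s t x' := by
  have hk : Continuous fun p : ℝ × ℝ × ℝ => s p.1 p.2.1 * s p.1 p.2.2 * d p.2.1 p.2.2 p.1 := by
    have h1 := hs.comp (by fun_prop : Continuous fun p : ℝ × ℝ × ℝ => (p.1, p.2.1))
    have h2 := hs.comp (by fun_prop : Continuous fun p : ℝ × ℝ × ℝ => (p.1, p.2.2))
    have h3 := hd.comp (by fun_prop : Continuous fun p : ℝ × ℝ × ℝ => (p.2.1, p.2.2, p.1))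
    exact (h1.mul h2).mul h3
  have hca : ∀ T, Continuous fun u => ∫ x in u..T, a u x := fun T => by
    rw [funext fun u => intervalIntegral.integral_symm (f := a u) T u]
    exact (intervalIntegral.continuous_parametric_intervalIntegral_of_continuous ha
      continuous_id).neg
  have hck : ∀ T, Continuous fun u => ∫ x in u..T, ∫ x' in u..T, s u x * s u x' * d x x' u :=
    fun T => by
    -- Both integrals are reversed so that `u` becomes the upper limit, the form required for
    -- continuity of parametric integrals.
    have e : ∀ u, ∫ x in u..T, ∫ x' in u..T, s u x * s u x' * d x x' u =
        -∫ x in T..u, -∫ x' in T..u, s u x * s u x' * d x x' u := fun u => by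
      rw [intervalIntegral.integral_symm]
      simp_rw [← intervalIntegral.integral_symm]
    rw [funext e]
    refine (intervalIntegral.continuous_parametric_intervalIntegral_of_continuous
      (f := fun u x => -∫ x' in T..u, s u x * s u x' * d x x' u) ?_ continuous_id).neg
    refine (intervalIntegral.continuous_parametric_intervalIntegral_of_continuous
      (X := ℝ × ℝ) (f := fun p x' => s p.1 p.2 * s p.1 x' * d p.2 x' p.1) ?_ continuous_fst).neg
    exact hk.comp (by fun_prop : Continuous fun q : (ℝ × ℝ) × ℝ => (q.1.1, q.1.2, q.2))
  -- Differentiation in `t` with `T` fixed.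
  have hloc : ∀ t T, t₀ ≤ t → t ≤ T → T ≤ E →
      2 * ∫ x in t..T, a t x = ∫ x in t..T, ∫ x' in t..T, s t x * s t x' * d x x' t := by
    intro t T ht htT hT
    rcases (ht.trans htT).eq_or_lt with h | h
    · obtain rfl : t = T := le_antisymm htT (h ▸ ht)
      simp
    · have h0 := eq_zero_of_integral_eq_zero (((hca T).const_mul 2).sub (hck T)) h
        (fun r hr => by
          simp only [Pi.sub_apply]
          rw [intervalIntegral.integral_sub
            (((hca T).const_mul 2).intervalIntegrable _ _) ((hck T).intervalIntegrable _ _),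
            intervalIntegral.integral_const_mul, hid T ⟨h.le, hT⟩ r hr, sub_self]) t ⟨ht, htT⟩
      exact sub_eq_zero.1 h0
  -- Differentiation in `T` with `t` fixed; `t < E` keeps the interval `[t, E]` nondegenerate.
  have hlt : ∀ t x, t₀ ≤ t → t ≤ x → x ≤ E → t < E →
      a t x = s t x * ∫ x' in t..x, d x x' t * s t x' := by
    intro t x ht htx hx htE
    have hkt : Continuous (uncurry fun x x' => s t x * s t x' * d x x' t) :=
      hk.comp (by fun_prop : Continuous fun q : ℝ × ℝ => (t, q.1, q.2))
    have hat : Continuous (a t) := ha.comp (by fun_prop : Continuous fun y : ℝ => (t, y))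
    have hlow : Continuous fun x => ∫ x' in t..x, s t x * s t x' * d x x' t :=
      intervalIntegral.continuous_parametric_intervalIntegral_of_continuous hkt continuous_id
    have h0 := eq_zero_of_integral_eq_zero (hat.sub hlow) htE (fun T hT => by
      have h1 := hloc t T ht hT.1 hT.2
      rw [integral_square_eq_two_mul_of_symm hkt hT.1 (fun y hy y' hy' => by
        rw [hsymm t y ⟨ht.trans hy.1, hy.2.trans hT.2⟩ y' ⟨ht.trans hy'.1, hy'.2.trans hT.2⟩]
        ring)] at h1
      simp only [Pi.sub_apply]
      rw [intervalIntegral.integral_sub (hat.intervalIntegrable _ _)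
        (hlow.intervalIntegrable _ _)]
      linarith) x ⟨htx, hx⟩
    rw [sub_eq_zero.1 h0, ← intervalIntegral.integral_const_mul]
    exact intervalIntegral.integral_congr fun x' _ => by ring
  intro t x ht htx hx
  rcases (htx.trans hx).lt_or_eq with h | rfl
  · exact hlt t x ht htx hx h
  -- The corner `t = x = E` is a limit of diagonal points, where the formula says that `a` vanishes.
  · obtain rfl : x = t := le_antisymm hx htx
    have hz : EqOn (fun y => a y y) 0 (Ioo t₀ x) := fun y hy => by
      simpa using hlt y y hy.1.le le_rfl hy.2.le hy.2
    have hdiag := hz.closure (ha.comp (by fun_prop : Continuous fun y : ℝ => (y, y)))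
      continuous_const
    rw [closure_Ioo hE.ne] at hdiag
    simpa using hdiag ⟨ht, le_rfl⟩

end DoubleIntegrals

/-! ### Mean of the discounted bond price. -/

section BondPrices

variable {Ω : Type*} [mΩ : MeasurableSpace Ω] {Q : Measure Ω} {t₀ T_FR : ℝ}

lemma indicator_mem_testPairs {h : ℝ → ℝ} (hh : Continuous h) {x b : ℝ}
    (hx : x ∈ Icc t₀ (t₀ + T_FR)) (hb : b ≤ x) :
    ((Icc t₀ b).indicator h, x) ∈ testPairs t₀ T_FR := by
  refine ⟨?_, hx, fun s hs => indicator_of_notMem (fun hm => hs ⟨hm.1, hm.2.trans hb⟩) _⟩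
  rw [memLp_indicator_iff_restrict measurableSet_Icc]
  obtain ⟨C, hC⟩ := (isCompact_Icc (a := t₀) (b := b)).exists_bound_of_continuousOn
    hh.continuousOn
  exact MemLp.of_bound hh.aestronglyMeasurable C
    ((ae_restrict_mem measurableSet_Icc).mono fun u hu => hC u hu)

/-- Noise accumulated up to times `b` and `c` is correlated only through the common period up to
`min b c`. -/
lemma integral_indicator_mul_indicator_mul {g h k : ℝ → ℝ} {b c : ℝ} (hb : t₀ ≤ b) (hc : t₀ ≤ c) :
    ∫ u, (Icc t₀ b).indicator g u * (Icc t₀ c).indicator h u * k u =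
      ∫ u in t₀..min b c, g u * h u * k u := by
  rw [intervalIntegral.integral_of_le (le_min hb hc), ← integral_Icc_eq_integral_Ioc,
    ← integral_indicator measurableSet_Icc]
  congr 1
  ext u
  by_cases h1 : u ∈ Icc t₀ b <;> by_cases h2 : u ∈ Icc t₀ c
  · rw [indicator_of_mem h1, indicator_of_mem h2, indicator_of_mem (show u ∈ Icc t₀ (min b c) from ⟨h1.1, le_min h1.2 h2.2⟩)]
  · rw [indicator_of_notMem h2, indicator_of_notMem
      (fun h : u ∈ Icc t₀ (min b c) => h2 ⟨h.1, h.2.trans (min_le_right _ _)⟩)]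
    simp
  all_goals
    rw [indicator_of_notMem h1, indicator_of_notMem
      (fun h : u ∈ Icc t₀ (min b c) => h1 ⟨h.1, h.2.trans (min_le_left _ _)⟩)]
    simp

variable {A : (ℝ → ℝ) → ℝ → Ω → ℝ} {a s : ℝ → ℝ → ℝ} {d : ℝ → ℝ → ℝ → ℝ} {f₀ : ℝ → ℝ}
  {f : ℝ → ℝ → Ω → ℝ}

lemma integral_discountedBondPrice [IsProbabilityMeasure Q]
    (hA : IsFieldWithPropagator Q t₀ T_FR d A)
    (ha : Continuous (uncurry a)) (hs : Continuous (uncurry s))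
    (hd : Continuous fun p : ℝ × ℝ × ℝ => d p.1 p.2.1 p.2.2)
    (hf₀ : IntervalIntegrable f₀ volume t₀ (t₀ + T_FR))
    (hf : IsForwardRate Q t₀ T_FR A a s f₀ f) {t T : ℝ} (ht : t₀ ≤ t) (htT : t ≤ T)
    (hT : T ≤ t₀ + T_FR) :
    ∫ ω, discountedBondPrice f t₀ t T ω ∂Q =
      Real.exp (-(∫ x in t₀..T, f₀ x) - (∫ u in t₀..t, ∫ x in u..T, a u x) +
        (∫ u in t₀..t, ∫ x in u..T, ∫ x' in u..T, s u x * s u x' * d x x' u) / 2) := by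
  have h0T : t₀ ≤ T := ht.trans htT
  set ν : Measure ℝ := volume.restrict (Ioc t₀ T) with hν
  -- Moving maturities into `[t₀, T]` makes `G` a Gaussian process for every real index, while
  -- nothing changes on the support of `ν`.
  set y : ℝ → ℝ := fun x => max t₀ (min T x) with hy
  have hyc : Continuous y := by fun_prop
  have hyI : ∀ x, y x ∈ Icc t₀ T := fun x => ⟨le_max_left _ _, max_le h0T (min_le_left _ _)⟩
  have hyE : ∀ x, y x ∈ Icc t₀ (t₀ + T_FR) := fun x => ⟨(hyI x).1, (hyI x).2.trans hT⟩
  have hyx : ∀ x ∈ Icc t₀ T, y x = x := fun x hx => by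
    simp only [hy, min_eq_right hx.2, max_eq_right hx.1]
  have hty : ∀ x, t₀ ≤ min t (y x) := fun x => le_min ht (hyI x).1
  set m : ℝ → ℝ := fun x => ∫ u in t₀..min t x, a u x with hm
  have hmc : Continuous m :=
    intervalIntegral.continuous_parametric_intervalIntegral_of_continuous
      (f := fun x u => a u x)
      (ha.comp (by fun_prop : Continuous fun q : ℝ × ℝ => (q.2, q.1))) (by fun_prop)
  -- The noise part of the rate. Time is stopped at `min t x`: for `x ≤ t` it is the spot rate
  -- `f(x,x)`, for `x ≥ t` the forward rate `f(t,x)` of the bond.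
  set G : ℝ → Ω → ℝ := fun x ω => f (min t (y x)) (y x) ω - f₀ (y x) - m (y x) with hG
  set k : ℝ → ℝ → ℝ → ℝ := fun u x x' => s u x * s u x' * d x x' u with hk
  have hkc : Continuous fun p : ℝ × ℝ × ℝ => k p.1 p.2.1 p.2.2 := by
    have h1 := hs.comp (by fun_prop : Continuous fun p : ℝ × ℝ × ℝ => (p.1, p.2.1))
    have h2 := hs.comp (by fun_prop : Continuous fun p : ℝ × ℝ × ℝ => (p.1, p.2.2))
    have h3 := hd.comp (by fun_prop : Continuous fun p : ℝ × ℝ × ℝ => (p.2.1, p.2.2, p.1))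
    exact (h1.mul h2).mul h3
  have hsc : ∀ x, Continuous fun u => s u x := fun x =>
    hs.comp (by fun_prop : Continuous fun u : ℝ => (u, x))
  have hpair : ∀ x, ((Icc t₀ (min t (y x))).indicator fun u => s u (y x), y x)
      ∈ testPairs t₀ T_FR := fun x =>
    indicator_mem_testPairs (hsc _) (hyE x) (min_le_right _ _)
  have hGA : ∀ x, A ((Icc t₀ (min t (y x))).indicator fun u => s u (y x)) (y x) =ᵐ[Q] G x := by
    intro x
    filter_upwards [hf.evolution (min t (y x)) (y x) ⟨hty x, min_le_right _ _, (hyE x).2⟩]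
      with ω hω
    simp only [hG, hω, hm]
    ring
  have hGauss : IsGaussianProcess G Q :=
    (hA.gaussian.comp_right fun x => ⟨_, hpair x⟩).congr hGA
  have hmean : ∀ x, ∫ ω, G x ω ∂Q = 0 := fun x => by
    rw [← integral_congr_ae (hGA x)]
    exact hA.mean _ _ (hpair x)
  have hcov : ∀ x x', ∫ ω, G x ω * G x' ω ∂Q =
      ∫ u in t₀..min t (min (y x) (y x')), k u (y x) (y x') := fun x x' => by
    have h0 : ∫ ω, G x ω * G x' ω ∂Q = ∫ ω, A _ (y x) ω * A _ (y x') ω ∂Q :=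
      integral_congr_ae ((hGA x).mul (hGA x')).symm
    have h1 := hA.correlator _ _ _ _ (hpair x) (hpair x')
    rw [integral_indicator_mul_indicator_mul (hty x) (hty x'), ← inf_inf_distrib_left] at h1
    exact h0.trans h1
  obtain ⟨C, hC⟩ : ∃ C, ∀ x, ∫ ω, G x ω ^ 2 ∂Q ≤ C := by
    have hv : Continuous fun z => ∫ u in t₀..min t z, k u z z :=
      intervalIntegral.continuous_parametric_intervalIntegral_of_continuous
        (f := fun z u => k u z z)
        (hkc.comp (by fun_prop : Continuous fun q : ℝ × ℝ => (q.2, q.1, q.1))) (by fun_prop)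
    obtain ⟨C, hC⟩ := (isCompact_Icc (a := t₀) (b := T)).exists_bound_of_continuousOn
      hv.continuousOn
    refine ⟨C, fun x => ?_⟩
    simp_rw [sq, hcov, min_self]
    exact (le_abs_self _).trans (hC _ (hyI x))
  have hGm : AEStronglyMeasurable (uncurry G) (ν.prod Q) := by
    have h1 : Measurable fun p : ℝ × Ω => f (min t (y p.1)) (y p.1) p.2 := by
      have : Measurable fun p : ℝ × Ω => (min t (y p.1), y p.1, p.2) := by
        have := hyc.measurable
        fun_prop
      exact hf.measurable.comp this
    have h2 : AEStronglyMeasurable (fun x => f₀ (y x)) ν := by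
      refine AEStronglyMeasurable.congr (f := f₀) ?_ ?_
      · exact (hf₀.1.mono_set (Ioc_subset_Ioc_right hT)).aestronglyMeasurable
      · exact (ae_restrict_mem measurableSet_Ioc).mono fun x hx => by
          simp only [hyx x (Ioc_subset_Icc_self hx)]
    have h3 : Measurable fun p : ℝ × Ω => m (y p.1) :=
      (hmc.comp hyc).measurable.comp measurable_fst
    exact (h1.aestronglyMeasurable.sub h2.comp_fst).sub h3.aestronglyMeasurable
  have hL : ∀ x, MemLp (G x) 2 Q := fun x => (hGauss.hasGaussianLaw_eval x).memLp_two
  -- Almost every path is integrable in the maturity, so the integrals of its parts may be added.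
  have hpath : ∀ᵐ ω ∂Q, Integrable (fun x => G x ω) ν :=
    (integrable_of_sq_bounded hGm hL hC).prod_left_ae
  have hf₀T : IntervalIntegrable f₀ volume t₀ T := by
    refine hf₀.mono_set ?_
    rw [uIcc_of_le h0T, uIcc_of_le (h0T.trans hT)]
    exact Icc_subset_Icc_right hT
  have hprice : ∀ᵐ ω ∂Q, discountedBondPrice f t₀ t T ω =
      Real.exp (-∫ x, G x ω ∂ν) *
        Real.exp (-(∫ x in t₀..T, f₀ x) - ∫ u in t₀..t, ∫ x in u..T, a u x) := by
    filter_upwards [hpath] with ω hω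
    have hGi : IntervalIntegrable (fun x => G x ω) volume t₀ T :=
      (intervalIntegrable_iff_integrableOn_Ioc_of_le h0T).2 hω
    have hsum : EqOn (fun x => G x ω + f₀ x + m x) (fun x => f (min t x) x ω) (Icc t₀ T) :=
      fun x hx => by
        simp only [hG, hyx x hx]
        ring
    have hYi : IntervalIntegrable (fun x => f (min t x) x ω) volume t₀ T := by
      refine ((hGi.add hf₀T).add (hmc.intervalIntegrable _ _)).congr fun x hx => hsum ?_
      rw [uIoc_of_le h0T] at hx
      exact Ioc_subset_Icc_self hx
    have e1 : ∫ r in t₀..t, f r r ω = ∫ x in t₀..t, f (min t x) x ω :=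
      intervalIntegral.integral_congr fun x hx => by
        rw [uIcc_of_le ht] at hx
        simp only [min_eq_right hx.2]
    have e2 : ∫ x in t..T, f t x ω = ∫ x in t..T, f (min t x) x ω :=
      intervalIntegral.integral_congr fun x hx => by
        rw [uIcc_of_le htT] at hx
        simp only [min_eq_left hx.1]
    have e3 : (∫ r in t₀..t, f r r ω) + ∫ x in t..T, f t x ω =
        (∫ x, G x ω ∂ν) + (∫ x in t₀..T, f₀ x) + ∫ u in t₀..t, ∫ x in u..T, a u x := by
      rw [e1, e2, intervalIntegral.integral_add_adjacent_intervals
        (hYi.mono_set (by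
          rw [uIcc_of_le h0T, uIcc_of_le ht]; exact Icc_subset_Icc_right htT))
        (hYi.mono_set (by
          rw [uIcc_of_le h0T, uIcc_of_le htT]; exact Icc_subset_Icc_left ht)),
        ← integral_triangle_swap ha ht htT, hν, ← intervalIntegral.integral_of_le h0T,
        ← intervalIntegral.integral_add hGi hf₀T, ← intervalIntegral.integral_add
          (hGi.add hf₀T) (hmc.intervalIntegrable _ _)]
      refine intervalIntegral.integral_congr fun x hx => ?_
      rw [uIcc_of_le h0T] at hx
      exact (hsum hx).symm
    rw [discountedBondPrice, bondPrice, ← Real.exp_add, ← Real.exp_add]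
    congr 1
    linarith
  have hvar : ∫ p : ℝ × ℝ, ∫ ω, G p.1 ω * G p.2 ω ∂Q ∂(ν.prod ν) =
      ∫ u in t₀..t, ∫ x in u..T, ∫ x' in u..T, k u x x' := by
    rw [← integral_pyramid_swap hkc ht htT]
    refine integral_congr_ae ?_
    rw [Measure.prod_restrict]
    filter_upwards [ae_restrict_mem (measurableSet_Ioc.prod measurableSet_Ioc)] with p hp
    rw [hcov, hyx _ (Ioc_subset_Icc_self hp.1), hyx _ (Ioc_subset_Icc_self hp.2)]
  rw [integral_congr_ae hprice, integral_mul_const,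
    integral_exp_neg_integral hGm hGauss hmean hC, hvar, ← Real.exp_add]
  congr 1
  ring

/-- The only consequence of the martingale property that is needed. -/
lemma integral_discountedBondPrice_eq [IsProbabilityMeasure Q] {ℱ : Filtration ℝ mΩ}
    (hQ : IsRiskNeutral Q ℱ t₀ T_FR f) {t T : ℝ} (ht : t₀ ≤ t) (htT : t ≤ T)
    (hT : T ≤ t₀ + T_FR) :
    ∫ ω, discountedBondPrice f t₀ t T ω ∂Q = ∫ ω, discountedBondPrice f t₀ t₀ T ω ∂Q := by
  have h := (hQ T ⟨ht.trans htT, hT⟩).setIntegral_eq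
    (i := ⟨t₀, le_rfl, ht.trans htT⟩) (j := ⟨t, ht, htT⟩) ht MeasurableSet.univ
  simpa using h.symm

/-- Testing the correlator on the indicator of `[t₀, b]` in both orders shows that `D x x'` and `D
x' x` have equal integrals over `[t₀, b]` for every `b ≤ min x x'`. Strictness of `t₀ < x` and `t₀ <
x'` leaves room to differentiate in `b`. -/
lemma propagator_symm (hA : IsFieldWithPropagator Q t₀ T_FR d A)
    (hd : Continuous fun p : ℝ × ℝ × ℝ => d p.1 p.2.1 p.2.2) {x x' u : ℝ}
    (hu : t₀ ≤ u) (hux : u ≤ x) (hux' : u ≤ x') (hx : x ≤ t₀ + T_FR) (hx' : x' ≤ t₀ + T_FR)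
    (h0x : t₀ < x) (h0x' : t₀ < x') : d x x' u = d x' x u := by
  have hc : ∀ z z' : ℝ, Continuous fun u => d z z' u := fun z z' =>
    hd.comp (by fun_prop : Continuous fun u : ℝ => (z, z', u))
  refine sub_eq_zero.1 (eq_zero_of_integral_eq_zero (a := t₀) (b := min x x')
    ((hc x x').sub (hc x' x)) (lt_min h0x h0x') (fun b hb => ?_) u ⟨hu, le_min hux hux'⟩)
  have h1 := indicator_mem_testPairs (t₀ := t₀) (T_FR := T_FR) (h := fun _ => 1)
    continuous_const ⟨h0x.le, hx⟩ (hb.2.trans (min_le_left _ _))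
  have h2 := indicator_mem_testPairs (t₀ := t₀) (T_FR := T_FR) (h := fun _ => 1)
    continuous_const ⟨h0x'.le, hx'⟩ (hb.2.trans (min_le_right _ _))
  have e1 := hA.correlator _ _ _ _ h1 h2
  have e2 := hA.correlator _ _ _ _ h2 h1
  rw [integral_indicator_mul_indicator_mul hb.1 hb.1] at e1 e2
  simp only [min_self, one_mul] at e1 e2
  simp only [Pi.sub_apply]
  rw [intervalIntegral.integral_sub ((hc x x').intervalIntegrable _ _)
    ((hc x' x).intervalIntegrable _ _), ← e1, ← e2, sub_eq_zero]
  exact integral_congr_ae (ae_of_all _ fun ω => mul_comm _ _)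

end BondPrices

/-! ### Reduction to coefficients continuous everywhere, by clamping the arguments. -/

section ContinuousExtension

variable {Ω : Type*} [mΩ : MeasurableSpace Ω] {Q : Measure Ω} {t₀ T_FR : ℝ}

/-- The point of `[a, b]` closest to `u`. -/
def clamp (a b u : ℝ) : ℝ := max a (min b u)

lemma continuous_clamp (a b : ℝ) : Continuous (clamp a b) := by
  unfold clamp
  fun_prop

lemma clamp_mem {a b : ℝ} (hab : a ≤ b) (u : ℝ) : clamp a b u ∈ Icc a b :=
  ⟨le_max_left _ _, max_le hab (min_le_left _ _)⟩

lemma clamp_of_mem {a b u : ℝ} (hu : u ∈ Icc a b) : clamp a b u = u := by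
  rw [clamp, min_eq_right hu.2, max_eq_right hu.1]

/-- The maturity in `[t, b]` attached to the maturity `x`, where `t` is `u` moved to `[a, b]`. -/
def clampMaturity (a b u x : ℝ) : ℝ := max (clamp a b u) (clamp a b x)

lemma clampMaturity_of_mem {u x : ℝ} (h : (u, x) ∈ rateDomain t₀ T_FR) :
    clampMaturity t₀ (t₀ + T_FR) u x = x ∧ clamp t₀ (t₀ + T_FR) u = u := by
  obtain ⟨h1, h2, h3⟩ := h
  have e1 := clamp_of_mem (a := t₀) (b := t₀ + T_FR) (u := u) ⟨h1, h2.trans h3⟩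
  have e2 := clamp_of_mem (a := t₀) (b := t₀ + T_FR) (u := x) ⟨h1.trans h2, h3⟩
  exact ⟨by rw [clampMaturity, e1, e2, max_eq_right h2], e1⟩

lemma clampMaturity_mem (hT : 0 ≤ T_FR) (u x : ℝ) :
    (clamp t₀ (t₀ + T_FR) u, clampMaturity t₀ (t₀ + T_FR) u x) ∈ rateDomain t₀ T_FR := by
  have h : t₀ ≤ t₀ + T_FR := by linarith
  exact ⟨(clamp_mem h u).1, le_max_left _ _, max_le (clamp_mem h u).2 (clamp_mem h x).2⟩

lemma continuous_clampMaturity (a b : ℝ) : Continuous (uncurry (clampMaturity a b)) := by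
  have := continuous_clamp a b
  unfold clampMaturity
  fun_prop

/-- The extension of a function on `rateDomain t₀ T_FR` to the plane. -/
def extendRate (t₀ T_FR : ℝ) (α : ℝ → ℝ → ℝ) (u x : ℝ) : ℝ :=
  α (clamp t₀ (t₀ + T_FR) u) (clampMaturity t₀ (t₀ + T_FR) u x)

/-- The extension of a function on `propagatorDomain t₀ T_FR` to space. -/
def extendPropagator (t₀ T_FR : ℝ) (D : ℝ → ℝ → ℝ → ℝ) (x x' u : ℝ) : ℝ :=
  D (clampMaturity t₀ (t₀ + T_FR) u x) (clampMaturity t₀ (t₀ + T_FR) u x')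
    (clamp t₀ (t₀ + T_FR) u)

lemma continuous_extendRate (hT : 0 ≤ T_FR) {α : ℝ → ℝ → ℝ}
    (hα : ContinuousOn (fun p : ℝ × ℝ => α p.1 p.2) (rateDomain t₀ T_FR)) :
    Continuous (uncurry (extendRate t₀ T_FR α)) := by
  have h1 := continuous_clamp t₀ (t₀ + T_FR)
  have h2 := continuous_clampMaturity t₀ (t₀ + T_FR)
  exact hα.comp_continuous ((h1.comp continuous_fst).prodMk h2) fun p =>
    clampMaturity_mem hT p.1 p.2

lemma continuous_extendPropagator (hT : 0 ≤ T_FR) {D : ℝ → ℝ → ℝ → ℝ}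
    (hD : ContinuousOn (fun p : ℝ × ℝ × ℝ => D p.1 p.2.1 p.2.2) (propagatorDomain t₀ T_FR)) :
    Continuous fun p : ℝ × ℝ × ℝ => extendPropagator t₀ T_FR D p.1 p.2.1 p.2.2 := by
  have h1 := continuous_clamp t₀ (t₀ + T_FR)
  have h2 := continuous_clampMaturity t₀ (t₀ + T_FR)
  exact hD.comp_continuous
    ((h2.comp (by fun_prop : Continuous fun p : ℝ × ℝ × ℝ => (p.2.2, p.1))).prodMk
      ((h2.comp (by fun_prop : Continuous fun p : ℝ × ℝ × ℝ => (p.2.2, p.2.1))).prodMk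
        (h1.comp (by fun_prop : Continuous fun p : ℝ × ℝ × ℝ => p.2.2))))
    fun p => ⟨clampMaturity_mem hT _ _, clampMaturity_mem hT _ _⟩

lemma extendRate_of_mem {α : ℝ → ℝ → ℝ} {u x : ℝ} (h : (u, x) ∈ rateDomain t₀ T_FR) :
    extendRate t₀ T_FR α u x = α u x := by
  rw [extendRate, (clampMaturity_of_mem h).1, (clampMaturity_of_mem h).2]

lemma extendPropagator_of_mem {D : ℝ → ℝ → ℝ → ℝ} {x x' u : ℝ}
    (h : (x, x', u) ∈ propagatorDomain t₀ T_FR) :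
    extendPropagator t₀ T_FR D x x' u = D x x' u := by
  rw [extendPropagator, (clampMaturity_of_mem h.1).1, (clampMaturity_of_mem h.2).1,
    (clampMaturity_of_mem h.1).2]

variable {A : (ℝ → ℝ) → ℝ → Ω → ℝ} {α σ : ℝ → ℝ → ℝ} {D : ℝ → ℝ → ℝ → ℝ} {f₀ : ℝ → ℝ}
  {f : ℝ → ℝ → Ω → ℝ}

/-- Test functions vanish outside the life of their rate, so the correlator sees the propagator only
on its domain. -/
lemma IsFieldWithPropagator.extend (hA : IsFieldWithPropagator Q t₀ T_FR D A) :
    IsFieldWithPropagator Q t₀ T_FR (extendPropagator t₀ T_FR D) A where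
  gaussian := hA.gaussian
  mean := hA.mean
  correlator h x g x' hx hx' := by
    rw [hA.correlator h x g x' hx hx']
    refine integral_congr_ae (ae_of_all _ fun u => ?_)
    by_cases h1 : u ∈ Icc t₀ x
    · by_cases h2 : u ∈ Icc t₀ x'
      · simp only
        rw [extendPropagator_of_mem ⟨⟨h1.1, h1.2, hx.2.1.2⟩, h2.1, h2.2, hx'.2.1.2⟩]
      · have h3 : g u = 0 := hx'.2.2 u h2
        simp [h3]
    · have h3 : h u = 0 := hx.2.2 u h1
      simp [h3]

lemma IsForwardRate.extend (hf : IsForwardRate Q t₀ T_FR A α σ f₀ f) :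
    IsForwardRate Q t₀ T_FR A (extendRate t₀ T_FR α) (extendRate t₀ T_FR σ) f₀ f where
  measurable := hf.measurable
  evolution t x htx := by
    have hmem : ∀ u ∈ Icc t₀ t, (u, x) ∈ rateDomain t₀ T_FR := fun u hu =>
      ⟨hu.1, hu.2.trans htx.2.1, htx.2.2⟩
    have e1 : ∫ u in t₀..t, extendRate t₀ T_FR α u x = ∫ u in t₀..t, α u x :=
      intervalIntegral.integral_congr fun u hu => by
        rw [uIcc_of_le htx.1] at hu
        exact extendRate_of_mem (hmem u hu)
    have e2 : ((Icc t₀ t).indicator fun u => extendRate t₀ T_FR σ u x) =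
        (Icc t₀ t).indicator fun u => σ u x :=
      indicator_congr fun u hu => extendRate_of_mem (hmem u hu)
    rw [e1, e2]
    exact hf.evolution t x htx

/-- Maturities equal to `t₀` escape `propagator_symm`; they are reached by continuity from the open
square. -/
lemma extendPropagator_symm (hT : 0 < T_FR) (hA : IsFieldWithPropagator Q t₀ T_FR D A)
    (hd : Continuous fun p : ℝ × ℝ × ℝ => extendPropagator t₀ T_FR D p.1 p.2.1 p.2.2)
    (u : ℝ) : ∀ x ∈ Icc t₀ (t₀ + T_FR), ∀ x' ∈ Icc t₀ (t₀ + T_FR),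
      extendPropagator t₀ T_FR D x x' u = extendPropagator t₀ T_FR D x' x u := by
  have hE : t₀ < t₀ + T_FR := by linarith
  set v := clamp t₀ (t₀ + T_FR) u
  have hidem : ∀ z z', extendPropagator t₀ T_FR D z z' u = extendPropagator t₀ T_FR D
      (clampMaturity t₀ (t₀ + T_FR) u z) (clampMaturity t₀ (t₀ + T_FR) u z') v := fun z z' => by
    exact (extendPropagator_of_mem
      ⟨clampMaturity_mem hT.le u z, clampMaturity_mem hT.le u z'⟩).symm
  have hpos : ∀ z ∈ Ioo t₀ (t₀ + T_FR), t₀ < clampMaturity t₀ (t₀ + T_FR) u z := fun z hz => by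
    rw [clampMaturity, clamp_of_mem (Ioo_subset_Icc_self hz)]
    exact hz.1.trans_le (le_max_right _ _)
  have hopen : EqOn (fun p : ℝ × ℝ => extendPropagator t₀ T_FR D p.1 p.2 u)
      (fun p => extendPropagator t₀ T_FR D p.2 p.1 u)
      (Ioo t₀ (t₀ + T_FR) ×ˢ Ioo t₀ (t₀ + T_FR)) := fun p hp => by
    have m1 := clampMaturity_mem (t₀ := t₀) hT.le u p.1
    have m2 := clampMaturity_mem (t₀ := t₀) hT.le u p.2
    simp only
    rw [hidem p.1, hidem p.2]
    exact propagator_symm hA.extend hd m1.1 m1.2.1 m2.2.1 m1.2.2 m2.2.2 (hpos _ hp.1)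
      (hpos _ hp.2)
  have hcl := hopen.closure
    (hd.comp (by fun_prop : Continuous fun p : ℝ × ℝ => (p.1, p.2, u)))
    (hd.comp (by fun_prop : Continuous fun p : ℝ × ℝ => (p.2, p.1, u)))
  rw [closure_prod_eq, closure_Ioo hE.ne] at hcl
  exact fun x hx x' hx' => hcl (mk_mem_prod hx hx')

/-- The drift restriction. -/
theorem drift_restriction [IsProbabilityMeasure Q] {ℱ : Filtration ℝ mΩ} (hT_FR : 0 < T_FR)
    (hD : ContinuousOn (fun p : ℝ × ℝ × ℝ => D p.1 p.2.1 p.2.2) (propagatorDomain t₀ T_FR))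
    (hA : IsFieldWithPropagator Q t₀ T_FR D A)
    (hα : ContinuousOn (fun p : ℝ × ℝ => α p.1 p.2) (rateDomain t₀ T_FR))
    (hσ : ContinuousOn (fun p : ℝ × ℝ => σ p.1 p.2) (rateDomain t₀ T_FR))
    (hf₀ : IntervalIntegrable f₀ volume t₀ (t₀ + T_FR))
    (hf : IsForwardRate Q t₀ T_FR A α σ f₀ f) (hQ : IsRiskNeutral Q ℱ t₀ T_FR f) {t x : ℝ}
    (htx : (t, x) ∈ rateDomain t₀ T_FR) :
    α t x = σ t x * ∫ x' in t..x, D x x' t * σ t x' := by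
  have ha := continuous_extendRate hT_FR.le hα
  have hs := continuous_extendRate hT_FR.le hσ
  have hd := continuous_extendPropagator hT_FR.le hD
  have key := drift_eq_of_integral_identity ha hs hd (by linarith : t₀ < t₀ + T_FR)
    -- The mean at time `r` is compared with that at `t₀`, where the drift and variance integrals
    -- are over an empty range.
    (extendPropagator_symm hT_FR hA hd) (fun T hT r hr => by
      have h1 := integral_discountedBondPrice_eq hQ hr.1 hr.2 hT.2
      rw [integral_discountedBondPrice hA.extend ha hs hd hf₀ hf.extend hr.1 hr.2 hT.2,
        integral_discountedBondPrice hA.extend ha hs hd hf₀ hf.extend le_rfl hT.1 hT.2,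
        Real.exp_eq_exp, intervalIntegral.integral_same, intervalIntegral.integral_same] at h1
      linarith) t x htx.1 htx.2.1 htx.2.2
  rw [extendRate_of_mem htx, extendRate_of_mem htx] at key
  rw [key]
  congr 1
  refine intervalIntegral.integral_congr fun x' hx' => ?_
  rw [uIcc_of_le htx.2.1] at hx'
  have hm : (t, x') ∈ rateDomain t₀ T_FR := ⟨htx.1, hx'.1, hx'.2.trans htx.2.2⟩
  rw [extendRate_of_mem hm, extendPropagator_of_mem ⟨htx, hm⟩]

end ContinuousExtension

end FieldHJM

theorem mainTheorem3 {Ω : Type*} [mΩ : MeasurableSpace Ω]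
    (Q : Measure Ω) [IsProbabilityMeasure Q] (ℱ : Filtration ℝ mΩ)
    (t₀ T_FR : ℝ) (hT_FR : 0 < T_FR)
    (D : ℝ → ℝ → ℝ → ℝ)
    (hD : ContinuousOn (fun p : ℝ × ℝ × ℝ => D p.1 p.2.1 p.2.2)
      (FieldHJM.propagatorDomain t₀ T_FR))
    (A : (ℝ → ℝ) → ℝ → Ω → ℝ) (hA : FieldHJM.IsFieldWithPropagator Q t₀ T_FR D A)
    (α σ : ℝ → ℝ → ℝ)
    (hα : ContinuousOn (fun p : ℝ × ℝ => α p.1 p.2) (FieldHJM.rateDomain t₀ T_FR))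
    (hσ : ContinuousOn (fun p : ℝ × ℝ => σ p.1 p.2) (FieldHJM.rateDomain t₀ T_FR))
    (f₀ : ℝ → ℝ) (hf₀ : IntervalIntegrable f₀ volume t₀ (t₀ + T_FR))
    (f : ℝ → ℝ → Ω → ℝ) (hf : FieldHJM.IsForwardRate Q t₀ T_FR A α σ f₀ f)
    (hQ : FieldHJM.IsRiskNeutral Q ℱ t₀ T_FR f) :
    -- the drift restriction
    (∀ t x, (t, x) ∈ FieldHJM.rateDomain t₀ T_FR →
      α t x = σ t x * ∫ x' in t..x, D x x' t * σ t x') ∧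
    -- with the propagator of the Lagrangian
    (∀ μ : ℝ, 0 ≤ μ →
      (∀ x x' t, (x, x', t) ∈ FieldHJM.propagatorDomain t₀ T_FR →
        D x x' t = FieldHJM.lagrangianPropagator μ T_FR x x' t) →
      ∀ t x, (t, x) ∈ FieldHJM.rateDomain t₀ T_FR →
        α t x = σ t x * ∫ x' in t..x, FieldHJM.lagrangianPropagator μ T_FR x x' t * σ t x') ∧
    -- the one factor HJM drift
    ((∀ x x' t, (x, x', t) ∈ FieldHJM.propagatorDomain t₀ T_FR → D x x' t = 1) →
      ∀ t x, (t, x) ∈ FieldHJM.rateDomain t₀ T_FR →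
        α t x = σ t x * ∫ x' in t..x, σ t x') := by
  have key : ∀ t x, (t, x) ∈ FieldHJM.rateDomain t₀ T_FR →
      α t x = σ t x * ∫ x' in t..x, D x x' t * σ t x' := fun t x htx =>
    FieldHJM.drift_restriction hT_FR hD hA hα hσ hf₀ hf hQ htx
  -- The formula evaluates `D` only on its domain, so any function agreeing with it there may
  -- replace it.
  have hcongr : ∀ D' : ℝ → ℝ → ℝ → ℝ,
      (∀ x x' t, (x, x', t) ∈ FieldHJM.propagatorDomain t₀ T_FR → D x x' t = D' x x' t) →
      ∀ t x, (t, x) ∈ FieldHJM.rateDomain t₀ T_FR →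
        α t x = σ t x * ∫ x' in t..x, D' x x' t * σ t x' := by
    intro D' hD' t x htx
    rw [key t x htx]
    congr 1
    refine intervalIntegral.integral_congr fun x' hx' => ?_
    rw [uIcc_of_le htx.2.1] at hx'
    rw [hD' x x' t ⟨htx, htx.1, hx'.1, hx'.2.trans htx.2.2⟩]
  refine ⟨key, fun μ _ hμ => hcongr _ hμ, fun h1 => ?_⟩
  simpa using hcongr (fun _ _ _ => 1) h1
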